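/- For integers $k\ge 2$ and $0\le d<k$, and for real $X\ge 1$, let $I_{k,d}(X)$ denote the number of integral solutions of the system $$x_1^j+\ldots+x_k^j=y_1^j+\ldots+y_k^j\qquad (1\le j\le k,\ j\ne k-d)$$ with $1\le x_i,y_i\le X$ $(1\le i\le k)$. Let $T_k(X)$ denote the number of pairs of integral $k$-tuples $(\mathbf x,\mathbf y)$ with $1\le x_i,y_i\le X$ $(1\le i\le k)$ for which $(x_1,\ldots,x_k)$ is a permutation of $(y_1,\ldots,y_k)$. In the following estimates, which hold for all real $X\ge 1$, the implicit constants depend at most on $k$. (i) Whenever $d\ge 1$ and $k\ge 4d+3$, one has $$I_{k,d}(X)=k!\,X^k+O(X^{k-1/2}).$$ (ii) Whenever $1\le d\le k/4$, one has $$I_{k,d}(X)-T_k(X)\ll X^{\sqrt{4k(d+1)+(d+1)^2}}.$$ (iii) There is an absolute constant $\eta_0>0$ such that, whenever $0<\eta\le \eta_0$ and $1\le d\le \eta^2k$, one has $$I_{k,d}(X)=T_k(X)+O(X^{3\eta k}).$$ -/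

import Mathlib

namespace Paucity

/-- All coordinates of the integral `s`-tuple `x` satisfy `1 ≤ x i ≤ X`. -/
def InBox {s : ℕ} (X : ℝ) (x : Fin s → ℤ) : Prop :=
  ∀ i, 1 ≤ x i ∧ (x i : ℝ) ≤ X

/-- The integral solutions `(x, y)` with `1 ≤ x i, y i ≤ X` of the system
`x₁ ^ j + ⋯ + x_k ^ j = y₁ ^ j + ⋯ + y_k ^ j` for `1 ≤ j ≤ k`, `j ≠ k - d`. -/
def solutions (k d : ℕ) (X : ℝ) : Set ((Fin k → ℤ) × (Fin k → ℤ)) :=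
  {p | InBox X p.1 ∧ InBox X p.2 ∧
    ∀ j : ℕ, 1 ≤ j → j ≤ k → j ≠ k - d → ∑ i, p.1 i ^ j = ∑ i, p.2 i ^ j}

/-- The pairs `(x, y)` of integral `s`-tuples with `1 ≤ x i, y i ≤ X` for which `x` is a
permutation of `y`. -/
def diagonals (s : ℕ) (X : ℝ) : Set ((Fin s → ℤ) × (Fin s → ℤ)) :=
  {p | InBox X p.1 ∧ InBox X p.2 ∧ ∃ σ : Equiv.Perm (Fin s), ∀ i, p.1 i = p.2 (σ i)}

/-- The counting function `I_{k,d}(X)`. -/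
noncomputable def I (k d : ℕ) (X : ℝ) : ℕ := (solutions k d X).ncard

/-- The counting function `T_s(X)`. -/
noncomputable def T (s : ℕ) (X : ℝ) : ℕ := (diagonals s X).ncard

theorem finite_inBox (s : ℕ) (X : ℝ) : {x : Fin s → ℤ | InBox X x}.Finite := by
  refine (Set.Finite.pi' (fun _ : Fin s => Set.finite_Icc (1 : ℤ) ⌊X⌋)).subset ?_
  intro x hx i
  exact ⟨(hx i).1, Int.le_floor.2 (hx i).2⟩

/-- The sets counted are finite, so that `Set.ncard` is the genuine number of elements. -/
theorem finite_solutions (k d : ℕ) (X : ℝ) : (solutions k d X).Finite :=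
  ((finite_inBox k X).prod (finite_inBox k X)).subset fun _ hp => ⟨hp.1, hp.2.1⟩

theorem finite_diagonals (s : ℕ) (X : ℝ) : (diagonals s X).Finite :=
  ((finite_inBox s X).prod (finite_inBox s X)).subset fun _ hp => ⟨hp.1, hp.2.1⟩

end Paucity

namespace Paucity

open Finset

/-! Put n = k - d and H = (-1)^n (e_n(x) - e_n(y)). By Newton's identities the single missing power
sum acts only through H: for a solution with 2d < k one has ∏(t - x_i) - ∏(t - y_i) = H τ(t), where
τ is monic of degree d with coefficients depending on x alone (`prod_sub_prod`). Off the diagonal H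
≠ 0.

Suppose y takes r distinct values v_a missed by x. Then ∏_i (v_a - x_i) = H τ(v_a), so every prime
in the array x_i - v_a divides H ∏ τ(v_a) ≪ N^(k-d+dr). Primes dividing some v_a - v_b aside, the
first row in which a prime occurs shows it in one column only, so in some column the primes making
their first appearance have product n ≪ N^((k-d)/r+d) (`exists_column`). Given v and n, the
coordinates x_i are recovered one after another with N^ε choices each, by Rankin's method
(`exists_card_primeFactors_subset_le`), and x together with one v_a fixes y up to permutation
(`exists_perm_of_common`). This gives O(N^(r+d+(k-d)/r+ε)) solutions.

Otherwise y has few distinct values, because values common to x and y are roots of τ; such solutions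
number O(N^(r+d)). Taking r = 2, together with an asymptotic formula for T, gives (i); taking r =
⌈√k⌉ gives (ii) and (iii). -/

/-! ### Newton's identities and the fundamental identity. -/

/-- The elementary symmetric polynomial of degree `j` in the coordinates of `x`. -/
def elem {k : ℕ} (x : Fin k → ℤ) (j : ℕ) : ℤ := ∑ t ∈ powersetCard j univ, ∏ i ∈ t, x i

/-- The polynomial consisting of the leading `d + 1` coefficients of `∏ i, (t - x i)`. -/
def trunc {k : ℕ} (x : Fin k → ℤ) (d : ℕ) (t : ℤ) : ℤ :=
  ∑ b ∈ range (d + 1), (-1) ^ b * elem x b * t ^ (d - b)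

theorem aeval_esymm {k : ℕ} (x : Fin k → ℤ) (j : ℕ) :
    MvPolynomial.aeval x (MvPolynomial.esymm (Fin k) ℤ j) = elem x j := by
  simp [MvPolynomial.esymm, elem]

theorem elem_zero {k : ℕ} (x : Fin k → ℤ) : elem x 0 = 1 := by
  simp [elem]

theorem newton {k : ℕ} (x : Fin k → ℤ) (j : ℕ) :
    (j : ℤ) * elem x j =
      (-1) ^ (j + 1) * ∑ a ∈ range j, (-1) ^ a * elem x a * ∑ i, x i ^ (j - a) := by
  have h := congrArg (MvPolynomial.aeval x) (MvPolynomial.mul_esymm_eq_sum (Fin k) ℤ j)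
  simp only [map_mul, map_natCast, aeval_esymm, map_pow, map_neg, map_one, map_sum,
    MvPolynomial.psum, MvPolynomial.aeval_X] at h
  rw [h, Finset.sum_filter, Finset.Nat.sum_antidiagonal_eq_sum_range_succ
    (fun a b => if a < j then (-1) ^ a * elem x a * ∑ i, x i ^ b else 0), Finset.sum_range_succ]
  simp only [lt_irrefl, if_false, add_zero]
  congr 1
  exact Finset.sum_congr rfl fun a ha => if_pos (mem_range.1 ha)

theorem prod_sub_eq_sum {k : ℕ} (x : Fin k → ℤ) (t : ℤ) :
    ∏ i, (t - x i) = ∑ j ∈ range (k + 1), (-1) ^ j * elem x j * t ^ (k - j) := by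
  have h := congrArg (Polynomial.eval t)
    (Multiset.prod_X_sub_X_eq_sum_esymm (Finset.univ.val.map x))
  have e : ∀ j, (Multiset.map x univ.val).esymm j = elem x j := fun j =>
    Finset.esymm_map_val x univ j
  simp only [Multiset.map_map, Polynomial.eval_finsetSum, Polynomial.eval_mul, Polynomial.eval_pow,
    Polynomial.eval_X, Polynomial.eval_C, Polynomial.eval_neg, Polynomial.eval_one, e,
    Multiset.card_map, Finset.card_val, Finset.card_univ, Fintype.card_fin, ← mul_assoc] at h
  rw [← h]
  change _ = Polynomial.eval t (∏ i : Fin k, (Polynomial.X - Polynomial.C (x i)))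
  simp [Polynomial.eval_prod]

/-- Equal products of linear factors belong to permuted tuples. -/
theorem exists_perm_of_prod_eq {k : ℕ} {x y : Fin k → ℤ}
    (h : ∀ t : ℤ, ∏ i, (t - x i) = ∏ i, (t - y i)) :
    ∃ σ : Equiv.Perm (Fin k), ∀ i, x i = y (σ i) := by
  have hp : ∏ i, (Polynomial.X - Polynomial.C (x i)) =
      ∏ i, (Polynomial.X - Polynomial.C (y i)) := by
    refine Polynomial.funext fun t => ?_
    simpa [Polynomial.eval_prod] using h t
  have hm : univ.val.map x = univ.val.map y := by
    have := congrArg Polynomial.roots hp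
    have e : ∀ z : Fin k → ℤ, ∏ i, (Polynomial.X - Polynomial.C (z i)) =
        ((univ.val.map z).map fun a => Polynomial.X - Polynomial.C a).prod := by
      intro z
      rw [Multiset.map_map]
      rfl
    rwa [e, e, Polynomial.roots_multiset_prod_X_sub_C, Polynomial.roots_multiset_prod_X_sub_C]
      at this
  have hc : ∀ c, Nonempty ({a // x a = c} ≃ {b // y b = c}) := by
    intro c
    rw [← Fintype.card_eq, Fintype.card_subtype, Fintype.card_subtype]
    have := congrArg (Multiset.count c) hm
    rw [Multiset.count_map, Multiset.count_map] at this
    simpa [Finset.card_def, eq_comm] using this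
  refine ⟨Equiv.ofFiberEquiv fun c => (hc c).some, fun i => ?_⟩
  exact (Equiv.ofFiberEquiv_map (fun c => (hc c).some) i).symm

theorem elem_eq_of_lt {k n : ℕ} {x y : Fin k → ℤ}
    (h : ∀ j, 1 ≤ j → j < n → ∑ i, x i ^ j = ∑ i, y i ^ j) (j : ℕ) (hj : j < n) :
    elem x j = elem y j := by
  induction j using Nat.strong_induction_on with
  | _ j ih =>
    rcases Nat.eq_zero_or_pos j with rfl | hpos
    · rw [elem_zero, elem_zero]
    · refine mul_left_cancel₀ (Nat.cast_ne_zero.2 hpos.ne' : (j : ℤ) ≠ 0) ?_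
      rw [newton, newton]
      congr 1
      refine Finset.sum_congr rfl fun a ha => ?_
      have ha := mem_range.1 ha
      rw [ih a ha (ha.trans hj), h (j - a) (by omega) (by omega)]

/-- In Newton's identity of degree n + m the missing power sum occurs once, multiplied by e_m; the
only other discrepancies are those of e_(n+a) with a < m, known by induction. The condition d < n
keeps e_m and the power sums of degree at most d unaffected. -/
theorem elem_sub_elem {k n d : ℕ} (hn : d < n) {x y : Fin k → ℤ}
    (h : ∀ j, 1 ≤ j → j ≤ n + d → j ≠ n → ∑ i, x i ^ j = ∑ i, y i ^ j) (m : ℕ) (hm : m ≤ d) :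
    elem x (n + m) - elem y (n + m) = (elem x n - elem y n) * elem x m := by
  have hlt := elem_eq_of_lt (n := n) (x := x) (y := y)
    (fun j h1 h2 => h j h1 (by omega) h2.ne)
  have hn0 : (n : ℤ) * (elem x n - elem y n) =
      (-1) ^ (n + 1) * (∑ i, x i ^ n - ∑ i, y i ^ n) := by
    obtain ⟨n, rfl⟩ : ∃ n', n = n' + 1 := ⟨n - 1, by omega⟩
    rw [mul_sub, newton, newton, ← mul_sub, ← Finset.sum_sub_distrib, Finset.sum_range_succ']
    rw [Finset.sum_eq_zero]
    · simp [elem_zero]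
    · intro a ha
      have ha := mem_range.1 ha
      rw [hlt (a + 1) (by omega), h (n + 1 - (a + 1)) (by omega) (by omega) (by omega), sub_self]
  induction m using Nat.strong_induction_on with
  | _ m ih =>
    rcases Nat.eq_zero_or_pos m with rfl | hpos
    · simp [elem_zero]
    refine mul_left_cancel₀ (Nat.cast_ne_zero.2 (by omega : n + m ≠ 0) : ((n + m : ℕ) : ℤ) ≠ 0) ?_
    have hN : ((n + m : ℕ) : ℤ) * (elem x (n + m) - elem y (n + m)) = (-1) ^ (n + m + 1) *
        (∑ a ∈ range n, ((-1) ^ a * elem x a * ∑ i, x i ^ (n + m - a) -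
            (-1) ^ a * elem y a * ∑ i, y i ^ (n + m - a)) +
          ∑ a ∈ range m, ((-1) ^ (n + a) * elem x (n + a) * ∑ i, x i ^ (n + m - (n + a)) -
            (-1) ^ (n + a) * elem y (n + a) * ∑ i, y i ^ (n + m - (n + a)))) := by
      rw [mul_sub, newton, newton, ← mul_sub, ← Finset.sum_sub_distrib, Finset.sum_range_add]
    have h1 : ∑ a ∈ range n, ((-1) ^ a * elem x a * ∑ i, x i ^ (n + m - a) -
            (-1) ^ a * elem y a * ∑ i, y i ^ (n + m - a)) =
        (-1) ^ m * elem x m * (∑ i, x i ^ n - ∑ i, y i ^ n) := by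
      rw [Finset.sum_eq_single_of_mem m (mem_range.2 (by omega))]
      · rw [hlt m (by omega), Nat.add_sub_cancel, mul_sub]
      · intro a ha hne
        have ha := mem_range.1 ha
        rw [hlt a ha, h (n + m - a) (by omega) (by omega) (by omega), sub_self]
    have h2 : ∑ a ∈ range m, ((-1) ^ (n + a) * elem x (n + a) * ∑ i, x i ^ (n + m - (n + a)) -
            (-1) ^ (n + a) * elem y (n + a) * ∑ i, y i ^ (n + m - (n + a))) =
        (-1) ^ n * (elem x n - elem y n) *
          ∑ a ∈ range m, (-1) ^ a * elem x a * ∑ i, x i ^ (m - a) := by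
      rw [Finset.mul_sum]
      refine Finset.sum_congr rfl fun a ha => ?_
      have ha := mem_range.1 ha
      rw [← h (n + m - (n + a)) (by omega) (by omega) (by omega), Nat.add_sub_add_left,
        ← sub_mul, ← mul_sub, ih a ha (by omega), pow_add]
      ring
    have h3 := newton x m
    have e1 : ((-1 : ℤ) ^ n) * (-1) ^ n = 1 := by rw [← mul_pow]; simp
    have e2 : ((-1 : ℤ) ^ m) * (-1) ^ m = 1 := by rw [← mul_pow]; simp
    rw [hN, h1, h2]
    rw [pow_succ] at hn0 h3
    push_cast
    set S := ∑ a ∈ range m, (-1) ^ a * elem x a * ∑ i, x i ^ (m - a)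
    set P := (∑ i, x i ^ n - ∑ i, y i ^ n)
    set D := elem x n - elem y n
    rw [pow_succ, pow_add]
    -- The missing power sum contributes n D e_m and the induction terms m D e_m, by Newton's
    -- identities of degrees n and m.
    linear_combination (-elem x m) * hn0 - D * h3 +
      (-(-1) ^ n * elem x m * P) * e2 + (-(-1) ^ m * D * S) * e1

theorem abs_elem_le {k : ℕ} {x : Fin k → ℤ} {N : ℤ} (hx : ∀ i, |x i| ≤ N) (hN : 0 ≤ N) (j : ℕ) :
    |elem x j| ≤ 2 ^ k * N ^ j := by
  have hN : 0 ≤ N ^ j := pow_nonneg hN _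
  calc |elem x j| ≤ ∑ t ∈ powersetCard j univ, |∏ i ∈ t, x i| := Finset.abs_sum_le_sum_abs _ _
    _ ≤ ∑ t ∈ powersetCard j (univ : Finset (Fin k)), N ^ j := by
        refine Finset.sum_le_sum fun t ht => ?_
        rw [Finset.abs_prod, ← (mem_powersetCard.1 ht).2]
        exact (Finset.prod_le_prod (fun i _ => abs_nonneg _) fun i _ => hx i).trans_eq
          (Finset.prod_const _)
    _ ≤ 2 ^ k * N ^ j := by
        rw [Finset.sum_const, nsmul_eq_mul]
        refine mul_le_mul_of_nonneg_right ?_ hN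
        rw [Finset.card_powersetCard, Finset.card_univ, Fintype.card_fin]
        exact_mod_cast Nat.choose_le_two_pow k j

/-- The fundamental identity for a solution of the system with the equation of degree `k - d`
removed. -/
theorem prod_sub_prod {k d : ℕ} (hd : 2 * d < k) {x y : Fin k → ℤ}
    (h : ∀ j, 1 ≤ j → j ≤ k → j ≠ k - d → ∑ i, x i ^ j = ∑ i, y i ^ j) (t : ℤ) :
    ∏ i, (t - x i) - ∏ i, (t - y i) =
      (-1) ^ (k - d) * (elem x (k - d) - elem y (k - d)) * trunc x d t := by
  obtain ⟨n, rfl⟩ : ∃ n, k = n + d := ⟨k - d, by omega⟩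
  simp only [Nat.add_sub_cancel] at h ⊢
  have hlt := elem_eq_of_lt (n := n) (x := x) (y := y)
    (fun j h1 h2 => h j h1 (by omega) h2.ne)
  rw [prod_sub_eq_sum, prod_sub_eq_sum, ← Finset.sum_sub_distrib, add_assoc, Finset.sum_range_add,
    Finset.sum_eq_zero, zero_add, trunc, Finset.mul_sum]
  · refine Finset.sum_congr rfl fun b hb => ?_
    have hb := mem_range.1 hb
    rw [Nat.add_sub_add_left, ← sub_mul, ← mul_sub,
      elem_sub_elem (by omega) h b (by omega), pow_add]
    ring
  · intro a ha
    rw [hlt a (mem_range.1 ha), sub_self]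

theorem abs_trunc_le {k d : ℕ} {x : Fin k → ℤ} {N t : ℤ} (hx : ∀ i, |x i| ≤ N) (hN : 0 ≤ N)
    (ht : |t| ≤ N) : |trunc x d t| ≤ (d + 1) * 2 ^ k * N ^ d := by
  calc |trunc x d t| ≤ ∑ b ∈ range (d + 1), |(-1) ^ b * elem x b * t ^ (d - b)| :=
        Finset.abs_sum_le_sum_abs _ _
    _ ≤ ∑ b ∈ range (d + 1), 2 ^ k * N ^ d := by
        refine Finset.sum_le_sum fun b hb => ?_
        have hb : b ≤ d := by have := mem_range.1 hb; omega
        rw [abs_mul, abs_mul, abs_pow, abs_pow, abs_neg, abs_one, one_pow, one_mul,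
          ← Nat.add_sub_cancel' hb, pow_add, ← mul_assoc, Nat.add_sub_cancel_left]
        exact mul_le_mul (abs_elem_le hx hN b) (pow_le_pow_left₀ (abs_nonneg _) ht _) (by positivity)
          (by positivity)
    _ = (d + 1) * 2 ^ k * N ^ d := by
        rw [Finset.sum_const, card_range, nsmul_eq_mul]; push_cast; ring

/-- The truncated polynomial is monic of degree `d`, and so has at most `d` roots. -/
theorem card_le_of_trunc_eq_zero {k d : ℕ} {x : Fin k → ℤ} {s : Finset ℤ}
    (hs : ∀ t ∈ s, trunc x d t = 0) : s.card ≤ d := by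
  set q : Polynomial ℤ := ∑ b ∈ range (d + 1),
    Polynomial.C ((-1) ^ b * elem x b) * Polynomial.X ^ (d - b) with hq
  have heval : ∀ t, q.eval t = trunc x d t := fun t => by
    simp [hq, trunc, Polynomial.eval_finsetSum]
  have hcoeff : q.coeff d = 1 := by
    rw [hq, Polynomial.finsetSum_coeff, Finset.sum_eq_single_of_mem 0 (by simp)]
    · simp [elem_zero]
    · intro b hb hb0
      rw [Polynomial.coeff_C_mul, Polynomial.coeff_X_pow, if_neg (by have := mem_range.1 hb; omega),
        mul_zero]
  have hq0 : q ≠ 0 := by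
    rintro h
    rw [h] at hcoeff
    simp at hcoeff
  have hdeg : q.natDegree ≤ d := by
    refine Polynomial.natDegree_sum_le_of_forall_le _ _ fun b _ => ?_
    exact (Polynomial.natDegree_C_mul_X_pow_le _ _).trans (Nat.sub_le _ _)
  exact (Polynomial.card_le_degree_of_subset_roots (fun t ht => by
    rw [Polynomial.mem_roots hq0, Polynomial.IsRoot, heval]
    exact hs t ht)).trans hdeg

/-- A solution is determined up to permutation by one block and one coordinate of the other. -/
theorem exists_perm_of_common {k d : ℕ} (hd : 2 * d < k) {x y y' : Fin k → ℤ}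
    (h : ∀ j, 1 ≤ j → j ≤ k → j ≠ k - d → ∑ i, x i ^ j = ∑ i, y i ^ j)
    (h' : ∀ j, 1 ≤ j → j ≤ k → j ≠ k - d → ∑ i, x i ^ j = ∑ i, y' i ^ j)
    {v : ℤ} (hv : ∃ i, y i = v) (hv' : ∃ i, y' i = v) (hx : ∀ i, x i ≠ v) :
    ∃ σ : Equiv.Perm (Fin k), ∀ i, y i = y' (σ i) := by
  have e := prod_sub_prod hd h
  have e' := prod_sub_prod hd h'
  have z : ∀ w : Fin k → ℤ, (∃ i, w i = v) → ∏ i, (v - w i) = 0 := fun w ⟨i, hi⟩ =>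
    Finset.prod_eq_zero (mem_univ i) (by rw [hi, sub_self])
  have hxv : ∏ i, (v - x i) ≠ 0 := Finset.prod_ne_zero_iff.2 fun i _ => sub_ne_zero.2 (hx i).symm
  have ev := e v
  have ev' := e' v
  rw [z y hv, sub_zero] at ev
  rw [z y' hv', sub_zero] at ev'
  have ht : trunc x d v ≠ 0 := by
    intro h0
    rw [h0, mul_zero] at ev
    exact hxv ev
  -- H is the quotient of ∏(v - x i) by the truncated polynomial at v, so `x` and `v` determine it.
  have hH := mul_right_cancel₀ ht (ev.symm.trans ev')
  refine exists_perm_of_prod_eq fun t => ?_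
  have e1 := e t
  have e2 := e' t
  rw [hH] at e1
  linarith

/-! ### Rankin's method. -/

/-- A uniform bound for the local factors in Rankin's method. -/
theorem exists_inv_one_sub_rpow_le {ε : ℝ} (hε : 0 < ε) :
    ∃ K : ℝ, 1 ≤ K ∧ ∃ Q : ℕ, ∀ p : ℕ, 2 ≤ p →
      (1 - (p : ℝ) ^ (-ε))⁻¹ ≤ (if p < Q then K else 1) * (p : ℝ) ^ ε := by
  have h2 : (2 : ℝ) ^ (-ε) < 1 := Real.rpow_lt_one_of_one_lt_of_neg one_lt_two (by linarith)
  have h2' : 0 < (2 : ℝ) ^ (-ε) := by positivity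
  -- From the threshold 2^(1/ε) on, p^ε ≥ 2, and the local factor, being at most 2, is absorbed by
  -- p^ε; only the boundedly many smaller primes cost `K`.
  refine ⟨(1 - (2 : ℝ) ^ (-ε))⁻¹, (one_le_inv₀ (by linarith)).2 (by linarith),
    ⌈(2 : ℝ) ^ ε⁻¹⌉₊, fun p hp => ?_⟩
  have hp' : (2 : ℝ) ≤ p := by exact_mod_cast hp
  have hpε : (p : ℝ) ^ (-ε) ≤ (2 : ℝ) ^ (-ε) :=
    Real.rpow_le_rpow_of_nonpos two_pos hp' (by linarith)
  have h1 : 1 ≤ (p : ℝ) ^ ε := Real.one_le_rpow (by linarith) hε.le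
  split_ifs with hQ
  · calc (1 - (p : ℝ) ^ (-ε))⁻¹ ≤ (1 - (2 : ℝ) ^ (-ε))⁻¹ :=
          inv_anti₀ (by linarith) (by linarith)
      _ ≤ _ := le_mul_of_one_le_right (inv_nonneg.2 (by linarith)) h1
  · have hge : (2 : ℝ) ^ ε⁻¹ ≤ p := Nat.ceil_le.1 (not_lt.1 hQ)
    have h3 : 2 ≤ (p : ℝ) ^ ε := by
      have := Real.rpow_le_rpow (by positivity) hge hε.le
      rwa [← Real.rpow_mul two_pos.le, inv_mul_cancel₀ hε.ne', Real.rpow_one] at this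
    have h4 : (p : ℝ) ^ (-ε) ≤ 1 / 2 := by
      rw [Real.rpow_neg (by linarith), one_div]
      exact inv_anti₀ two_pos h3
    rw [one_mul]
    refine le_trans ?_ h3
    rw [inv_le_comm₀ (by linarith) two_pos]
    linarith

/-- Few integers are composed only of primes dividing a given integer. -/
theorem exists_card_primeFactors_subset_le {ε : ℝ} (hε : 0 < ε) :
    ∃ C : ℝ, 0 < C ∧ ∀ N W : ℕ, W ≠ 0 →
      (((Icc 1 N).filter fun s => s.primeFactors ⊆ W.primeFactors).card : ℝ) ≤
        C * ((N : ℝ) * W) ^ ε := by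
  obtain ⟨K, hK, Q, hQ⟩ := exists_inv_one_sub_rpow_le hε
  refine ⟨K ^ Q, by positivity, fun N W hW => ?_⟩
  set f : ℕ →* ℝ :=
    { toFun := fun n => (n : ℝ) ^ (-ε)
      map_one' := by simp
      map_mul' := fun a b => by
        push_cast
        exact Real.mul_rpow (Nat.cast_nonneg _) (Nat.cast_nonneg _) } with hf
  have hfa : ∀ n : ℕ, f n = (n : ℝ) ^ (-ε) := fun n => rfl
  have hsum : ∀ {p : ℕ}, p.Prime → ‖f p‖ < 1 := by
    intro p hp
    rw [hfa, Real.norm_of_nonneg (by positivity)]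
    exact Real.rpow_lt_one_of_one_lt_of_neg (by exact_mod_cast hp.one_lt) (by linarith)
  obtain ⟨-, hS⟩ :=
    EulerProduct.summable_and_hasSum_factoredNumbers_prod_filter_prime_geometric hsum
      W.primeFactors
  have hfil : W.primeFactors.filter Nat.Prime = W.primeFactors :=
    Finset.filter_true_of_mem fun p hp => Nat.prime_of_mem_primeFactors hp
  rw [hfil] at hS
  set A := (Icc 1 N).filter fun s => s.primeFactors ⊆ W.primeFactors with hA
  have hmem : ∀ s ∈ A, s ∈ Nat.factoredNumbers W.primeFactors := fun s hs =>
    Nat.mem_factoredNumbers_iff_primeFactors_subset.2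
      ⟨by have := (mem_Icc.1 (mem_filter.1 hs).1).1; omega, (mem_filter.1 hs).2⟩
  have h1 : ∑ s ∈ A, f s ≤ ∏ p ∈ W.primeFactors, (1 - f p)⁻¹ := by
    have := sum_le_hasSum (A.attach.map
      ⟨fun s => (⟨s.1, hmem s.1 s.2⟩ : Nat.factoredNumbers W.primeFactors), fun a b h => by
        exact Subtype.ext (congrArg Subtype.val h :)⟩) (fun i _ => by rw [hfa]; positivity) hS
    rw [Finset.sum_map] at this
    exact (Finset.sum_attach A f).symm.trans_le this
  have h2 : ∏ p ∈ W.primeFactors, (1 - f p)⁻¹ ≤ K ^ Q * (W : ℝ) ^ ε := by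
    calc ∏ p ∈ W.primeFactors, (1 - f p)⁻¹
        ≤ ∏ p ∈ W.primeFactors, ((if p < Q then K else 1) * (p : ℝ) ^ ε) := by
          refine Finset.prod_le_prod (fun p hp => ?_) fun p hp => ?_
          · have := hsum (Nat.prime_of_mem_primeFactors hp)
            rw [Real.norm_eq_abs] at this
            exact inv_nonneg.2 (by linarith [le_abs_self (f p)])
          · exact hQ p (Nat.prime_of_mem_primeFactors hp).two_le
      _ = K ^ (W.primeFactors.filter (· < Q)).card * ((∏ p ∈ W.primeFactors, p : ℕ) : ℝ) ^ ε := by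
          rw [Finset.prod_mul_distrib, Finset.prod_ite, Finset.prod_const, Finset.prod_const_one,
            mul_one, Nat.cast_prod, Real.finsetProd_rpow _ _ fun _ _ => Nat.cast_nonneg _]
      _ ≤ K ^ Q * (W : ℝ) ^ ε := by
          refine mul_le_mul (pow_le_pow_right₀ hK ?_) (Real.rpow_le_rpow (by positivity) ?_ hε.le)
            (by positivity) (by positivity)
          · calc _ ≤ (range Q).card := Finset.card_le_card fun p hp => by
                  simpa using (mem_filter.1 hp).2
              _ = Q := card_range Q
          · exact_mod_cast Nat.le_of_dvd (Nat.pos_of_ne_zero hW) (Nat.prod_primeFactors_dvd W)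
  -- Rankin's trick: each s ≤ N is weighted by (N/s)^ε ≥ 1, and the sum of s^(-ε) is at most an
  -- Euler product over the primes of `W`.
  calc (A.card : ℝ) = ∑ s ∈ A, 1 := by simp
    _ ≤ ∑ s ∈ A, (N : ℝ) ^ ε * f s := by
        refine Finset.sum_le_sum fun s hs => ?_
        have hs := mem_Icc.1 (mem_filter.1 hs).1
        have hs0 : (0 : ℝ) < s := by exact_mod_cast hs.1
        rw [hfa, Real.rpow_neg hs0.le, ← div_eq_mul_inv, one_le_div (by positivity)]
        exact Real.rpow_le_rpow hs0.le (by exact_mod_cast hs.2) hε.le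
    _ = (N : ℝ) ^ ε * ∑ s ∈ A, f s := (Finset.mul_sum _ _ _).symm
    _ ≤ (N : ℝ) ^ ε * (K ^ Q * (W : ℝ) ^ ε) :=
        mul_le_mul_of_nonneg_left (h1.trans h2) (by positivity)
    _ = K ^ Q * ((N : ℝ) * W) ^ ε := by
        rw [Real.mul_rpow (Nat.cast_nonneg _) (Nat.cast_nonneg _)]; ring

/-! ### The array of differences and its columns. -/

/-- A set of tuples in which each coordinate has at most `B` values once the earlier coordinates
are given has at most `B ^ k` elements. -/
theorem card_le_pow_of_prefix {α : Type*} [DecidableEq α] (B k : ℕ) (S : Finset (Fin k → α))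
    (h : ∀ i : Fin k, ∀ z ∈ S,
      ((S.filter fun x => ∀ i' < i, x i' = z i').image fun x => x i).card ≤ B) :
    S.card ≤ B ^ k := by
  induction k with
  | zero => simpa using Finset.card_le_one_of_subsingleton S
  | succ k ih =>
    have h1 : S.card ≤ B * (S.image (Fin.init (α := fun _ => α))).card := by
      refine Finset.card_le_mul_card_image S B fun b hb => ?_
      obtain ⟨z, hz, rfl⟩ := mem_image.1 hb
      refine le_trans ?_ (h (Fin.last k) z hz)
      rw [← Finset.card_image_of_injOn (f := fun x => x (Fin.last k))]
      · refine Finset.card_le_card (Finset.image_subset_image fun x hx => ?_)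
        obtain ⟨hx, he⟩ := mem_filter.1 hx
        refine mem_filter.2 ⟨hx, fun i' hi' => ?_⟩
        have := congrFun he (i'.castPred hi'.ne)
        simpa [Fin.init] using this
      · intro x hx x' hx' hl
        have hx := (mem_filter.1 hx).2
        have hx' := (mem_filter.1 hx').2
        rw [← Fin.snoc_init_self (α := fun _ => α) x, ← Fin.snoc_init_self (α := fun _ => α) x',
          hx, hx']
        exact congrArg _ hl
    have h2 : (S.image (Fin.init (α := fun _ => α))).card ≤ B ^ k := by
      refine ih _ fun i z' hz' => ?_
      obtain ⟨z, hz, rfl⟩ := mem_image.1 hz'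
      refine le_trans (Finset.card_le_card fun a ha => ?_) (h i.castSucc z hz)
      obtain ⟨x', hx', rfl⟩ := mem_image.1 ha
      obtain ⟨hx', hp⟩ := mem_filter.1 hx'
      obtain ⟨x, hx, rfl⟩ := mem_image.1 hx'
      refine mem_image.2 ⟨x, mem_filter.2 ⟨hx, fun i' hi' => ?_⟩, rfl⟩
      have hne : i' ≠ Fin.last k := (hi'.trans (Fin.castSucc_lt_last i)).ne
      have := hp (i'.castPred hne) (by
        rw [Fin.lt_def] at hi' ⊢
        simpa using hi')
      simpa [Fin.init] using this
    calc S.card ≤ B * B ^ k := h1.trans (Nat.mul_le_mul_left _ h2)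
      _ = B ^ (k + 1) := (pow_succ' B k).symm

/-- The product of the differences of the coordinates of `v`. -/
def diffProd {r : ℕ} (v : Fin r → ℤ) : ℤ := ∏ a, ∏ b ∈ univ.erase a, (v a - v b)

/-- The product of the differences `x i' - v a` with `i' < i`. -/
def prefixProd {k r : ℕ} (x : Fin k → ℤ) (v : Fin r → ℤ) (i : Fin k) : ℤ :=
  ∏ i' ∈ Iio i, ∏ a, (x i' - v a)

theorem diffProd_ne_zero {r : ℕ} {v : Fin r → ℤ} (hv : Function.Injective v) :
    diffProd v ≠ 0 :=
  Finset.prod_ne_zero_iff.2 fun _ _ => Finset.prod_ne_zero_iff.2 fun _ hb =>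
    sub_ne_zero.2 fun h => (mem_erase.1 hb).1 (hv h).symm

theorem prefixProd_ne_zero {k r : ℕ} {x : Fin k → ℤ} {v : Fin r → ℤ}
    (h : ∀ i a, x i ≠ v a) (i : Fin k) : prefixProd x v i ≠ 0 :=
  Finset.prod_ne_zero_iff.2 fun _ _ => Finset.prod_ne_zero_iff.2 fun _ _ => sub_ne_zero.2 (h _ _)

theorem exists_pow_le_of_prod_le {r Z : ℕ} (hr : 0 < r) (hZ : 0 < Z) {n : Fin r → ℕ}
    (h : ∏ p, n p ≤ Z) : ∃ p, n p ^ r ≤ Z := by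
  by_contra! hlt
  have h1 : ∏ _p : Fin r, Z < ∏ p, n p ^ r :=
    Finset.prod_lt_prod_of_nonempty (fun _ _ => hZ) (fun p _ => hlt p) ⟨⟨0, hr⟩, mem_univ _⟩
  rw [Finset.prod_const, Finset.card_univ, Fintype.card_fin, Finset.prod_pow] at h1
  exact absurd (Nat.pow_le_pow_left h r) (not_le.2 h1)

/-- In one of the columns of the array `x i - v p`, the primes that appear there for the first time
have a small product. -/
theorem exists_column {k r : ℕ} (hr : 0 < r) {x : Fin k → ℤ} {v : Fin r → ℤ}
    (hv : Function.Injective v)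
    (hx : ∀ i a, x i ≠ v a) {H : ℤ} {τ : Fin r → ℤ}
    (hH : ∀ a, ∏ i, (v a - x i) = H * τ a) :
    ∃ p, ∃ n : ℕ, 0 < n ∧ n ^ r ≤ (H * ∏ a, τ a).natAbs ∧
      ∀ i, (x i - v p).natAbs.primeFactors ⊆
        ((n : ℤ) * diffProd v * prefixProd x v i).natAbs.primeFactors := by
  classical
  set Z := (H * ∏ a, τ a).natAbs with hZ
  have hHτ : ∀ a, H * τ a ≠ 0 := fun a => by
    rw [← hH a]
    exact Finset.prod_ne_zero_iff.2 fun i _ => sub_ne_zero.2 (hx i a).symm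
  have hZ0 : 0 < Z := Int.natAbs_pos.2 (mul_ne_zero (left_ne_zero_of_mul (hHτ ⟨0, hr⟩))
    (Finset.prod_ne_zero_iff.2 fun a _ => right_ne_zero_of_mul (hHτ a)))
  -- `B p` collects the primes whose first row of occurrence, over all columns, shows them in column
  -- `p`. Two columns in that same row would force the prime to divide some v p - v p', which is
  -- excluded.
  set B : Fin r → Finset ℕ := fun p => Z.primeFactors.filter fun q =>
    ¬ (q : ℤ) ∣ diffProd v ∧ ∃ i, (q : ℤ) ∣ x i - v p ∧ ∀ i' < i, ∀ a, ¬ (q : ℤ) ∣ x i' - v a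
    with hB
  have hdisj : ∀ p ∈ univ, ∀ p' ∈ univ, p ≠ p' → Disjoint (B p) (B p') := by
    intro p _ p' _ hne
    rw [Finset.disjoint_left]
    intro q hq hq'
    obtain ⟨-, hΔ, i, hi, hmin⟩ := mem_filter.1 hq
    obtain ⟨-, -, i', hi', hmin'⟩ := mem_filter.1 hq'
    rcases lt_trichotomy i i' with hlt | rfl | hlt
    · exact hmin' i hlt p hi
    · refine hΔ ?_
      have h1 : (q : ℤ) ∣ v p - v p' := by
        have := dvd_sub hi' hi
        rwa [sub_sub_sub_cancel_left] at this
      exact h1.trans ((Finset.dvd_prod_of_mem (fun b => v p - v b)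
        (mem_erase.2 ⟨hne.symm, mem_univ p'⟩)).trans
        (Finset.dvd_prod_of_mem (fun a => ∏ b ∈ univ.erase a, (v a - v b)) (mem_univ p)))
    · exact hmin i' hlt p' hi'
  have hprod : ∏ p, ∏ q ∈ B p, q ≤ Z := by
    rw [← Finset.prod_biUnion hdisj]
    refine Nat.le_of_dvd hZ0 (dvd_trans (Finset.prod_dvd_prod_of_subset _ _ _ ?_)
      (Nat.prod_primeFactors_dvd Z))
    exact Finset.biUnion_subset.2 fun p _ => Finset.filter_subset _ _
  obtain ⟨p, hp⟩ := exists_pow_le_of_prod_le hr hZ0 hprod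
  refine ⟨p, ∏ q ∈ B p, q, Finset.prod_pos fun q hq =>
    (Nat.prime_of_mem_primeFactors (mem_filter.1 hq).1).pos, hp, fun i q hq => ?_⟩
  have hqp := Nat.prime_of_mem_primeFactors hq
  have hqd : (q : ℤ) ∣ x i - v p := Int.natCast_dvd.2 (Nat.dvd_of_mem_primeFactors hq)
  rw [Nat.mem_primeFactors]
  refine ⟨hqp, Int.natCast_dvd.1 ?_, Int.natAbs_ne_zero.2 (mul_ne_zero (mul_ne_zero ?_
    (diffProd_ne_zero hv)) (prefixProd_ne_zero hx i))⟩
  -- A prime of x i - v p divides a difference of values, or occurs in an earlier row, or is new in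
  -- row `i` and hence lies in `B p`.
  · by_cases hΔ : (q : ℤ) ∣ diffProd v
    · exact dvd_mul_of_dvd_left (dvd_mul_of_dvd_right hΔ _) _
    by_cases hpre : ∃ i' < i, ∃ a, (q : ℤ) ∣ x i' - v a
    · obtain ⟨i', hi', a, ha⟩ := hpre
      exact dvd_mul_of_dvd_right ((ha.trans (Finset.dvd_prod_of_mem (fun a => x i' - v a)
        (mem_univ a))).trans (Finset.dvd_prod_of_mem (fun i' => ∏ a, (x i' - v a))
        (mem_Iio.2 hi'))) _
    · push Not at hpre
      refine dvd_mul_of_dvd_left (dvd_mul_of_dvd_left (Int.natCast_dvd_natCast.2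
        (Finset.dvd_prod_of_mem (fun q => q) (mem_filter.2 ⟨?_, hΔ, i, hqd, hpre⟩))) _) _
      refine Nat.mem_primeFactors.2 ⟨hqp, Int.natCast_dvd.1 ?_, hZ0.ne'⟩
      have h1 : (q : ℤ) ∣ ∏ i, (v p - x i) :=
        ((dvd_sub_comm).1 hqd).trans (Finset.dvd_prod_of_mem (fun i => v p - x i) (mem_univ i))
      rw [hH p] at h1
      exact h1.trans (mul_dvd_mul_left _ (Finset.dvd_prod_of_mem τ (mem_univ p)))
  · exact Nat.cast_ne_zero.2 (Finset.prod_pos fun q hq =>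
      (Nat.prime_of_mem_primeFactors (mem_filter.1 hq).1).pos).ne'

theorem natAbs_sub_le {N : ℕ} {a b : ℤ} (ha : a ∈ Icc 1 (N : ℤ)) (hb : b ∈ Icc 1 (N : ℤ)) :
    (a - b).natAbs ≤ N := by
  rw [mem_Icc] at ha hb
  omega

theorem natAbs_diffProd_le {r N : ℕ} {v : Fin r → ℤ} (hv : ∀ a, v a ∈ Icc 1 (N : ℤ)) :
    (diffProd v).natAbs ≤ N ^ ((r - 1) * r) := by
  rw [diffProd, ← Int.natAbsHom_apply, map_prod]
  simp_rw [map_prod, Int.natAbsHom_apply]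
  calc _ ≤ ∏ a : Fin r, ∏ b ∈ univ.erase a, N := Finset.prod_le_prod' fun a _ =>
        Finset.prod_le_prod' fun b _ => natAbs_sub_le (hv a) (hv b)
    _ = N ^ ((r - 1) * r) := by simp [Finset.card_erase_of_mem, pow_mul]

theorem natAbs_prefixProd_le {k r N : ℕ} (hN : 0 < N) {x : Fin k → ℤ} {v : Fin r → ℤ}
    (hx : ∀ i, x i ∈ Icc 1 (N : ℤ)) (hv : ∀ a, v a ∈ Icc 1 (N : ℤ)) (i : Fin k) :
    (prefixProd x v i).natAbs ≤ N ^ (r * k) := by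
  rw [prefixProd, ← Int.natAbsHom_apply, map_prod]
  simp_rw [map_prod, Int.natAbsHom_apply]
  calc _ ≤ ∏ i' ∈ Iio i, ∏ a : Fin r, N := Finset.prod_le_prod' fun a _ =>
        Finset.prod_le_prod' fun b _ => natAbs_sub_le (hx _) (hv b)
    _ = N ^ (r * (Iio i).card) := by simp [pow_mul]
    _ ≤ N ^ (r * k) := Nat.pow_le_pow_right hN (Nat.mul_le_mul_left _
        ((Finset.card_le_univ _).trans_eq (Fintype.card_fin k)))

/-! ### Counting the generic nondiagonal solutions. -/

/-- The integral `s`-tuples with coordinates in `[1, N]`. -/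
noncomputable def box (s N : ℕ) : Finset (Fin s → ℤ) := Fintype.piFinset fun _ => Icc 1 (N : ℤ)

theorem mem_box {s N : ℕ} {x : Fin s → ℤ} : x ∈ box s N ↔ ∀ i, x i ∈ Icc 1 (N : ℤ) :=
  Fintype.mem_piFinset

theorem card_box (s N : ℕ) : (box s N).card = N ^ s := by
  simp [box]

theorem abs_le_of_mem_Icc {N : ℕ} {a : ℤ} (h : a ∈ Icc 1 (N : ℤ)) : |a| ≤ N := by
  rw [mem_Icc] at h
  rw [abs_le]
  omega

/-- The defining system of equations. -/
def IsSol (k d : ℕ) (x y : Fin k → ℤ) : Prop :=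
  ∀ j : ℕ, 1 ≤ j → j ≤ k → j ≠ k - d → ∑ i, x i ^ j = ∑ i, y i ^ j

open Classical in
/-- The solutions in `[1, N]` that are not diagonal. -/
noncomputable def nondiag (k d N : ℕ) : Finset ((Fin k → ℤ) × (Fin k → ℤ)) :=
  (box k N ×ˢ box k N).filter fun p => IsSol k d p.1 p.2 ∧
    ¬ ∃ σ : Equiv.Perm (Fin k), ∀ i, p.1 i = p.2 (σ i)

theorem mem_nondiag {k d N : ℕ} {x y : Fin k → ℤ} : (x, y) ∈ nondiag k d N ↔
    (x ∈ box k N ∧ y ∈ box k N) ∧ IsSol k d x y ∧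
      ¬ ∃ σ : Equiv.Perm (Fin k), ∀ i, x i = y (σ i) := by
  simp only [nondiag, mem_filter, mem_product]

/-- A set of pairs whose members over a given tuple have permuted second blocks is not much larger
than its first projection. -/
theorem card_le_of_perm {k : ℕ} {α : Type*} [DecidableEq α] {G : Finset (α × (Fin k → ℤ))}
    (h : ∀ x y y', (x, y) ∈ G → (x, y') ∈ G → ∃ σ : Equiv.Perm (Fin k), ∀ i, y i = y' (σ i)) :
    G.card ≤ k.factorial * (G.image Prod.fst).card := by
  classical
  refine Finset.card_le_mul_card_image G _ fun x hx => ?_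
  obtain ⟨⟨x, y'⟩, hy', rfl⟩ := mem_image.1 hx
  calc _ ≤ ((univ : Finset (Equiv.Perm (Fin k))).image fun σ => (x, fun i => y' (σ i))).card := by
        refine Finset.card_le_card fun p hp => ?_
        obtain ⟨x₁, y⟩ := p
        obtain ⟨hp', he⟩ := mem_filter.1 hp
        obtain rfl : x₁ = x := he
        obtain ⟨σ, hσ⟩ := h _ _ _ hp' hy'
        exact mem_image.2 ⟨σ, mem_univ _, Prod.ext rfl (funext fun i => (hσ i).symm)⟩
    _ ≤ (univ : Finset (Equiv.Perm (Fin k))).card := Finset.card_image_le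
    _ = k.factorial := by rw [Finset.card_univ, Fintype.card_perm, Fintype.card_fin]

open Classical in
/-- The nondiagonal solutions `(x, y)` for which the values `v a` are taken by `y` but not by `x`,
and the primes dividing `x i - v p` are controlled by `n` and the earlier coordinates. -/
noncomputable def column (k d N : ℕ) {r : ℕ} (p : Fin r) (v : Fin r → ℤ) (n : ℕ) :
    Finset ((Fin k → ℤ) × (Fin k → ℤ)) :=
  (nondiag k d N).filter fun z => (∀ a, ∃ i, z.2 i = v a) ∧ Function.Injective v ∧
    (∀ i a, z.1 i ≠ v a) ∧ ∀ i, (z.1 i - v p).natAbs.primeFactors ⊆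
      ((n : ℤ) * diffProd v * prefixProd z.1 v i).natAbs.primeFactors

/-- The coordinates of `x` are chosen in turn, each with at most 2R values; the factorial accounts
for `y`, which is fixed up to permutation by `x` and `v p`. -/
theorem card_column_le {k d N r : ℕ} (hd : 2 * d < k) (hN : 0 < N) {C ε : ℝ} (hC : 0 ≤ C)
    (hε : 0 ≤ ε)
    (hdiv : ∀ N W : ℕ, W ≠ 0 →
      (((Icc 1 N).filter fun s => s.primeFactors ⊆ W.primeFactors).card : ℝ) ≤
        C * ((N : ℝ) * W) ^ ε)
    (p : Fin r) (v : Fin r → ℤ) {n M : ℕ} (hn : 0 < n) (hM : n ≤ M) :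
    ((column k d N p v n).card : ℝ) ≤ k.factorial *
      (2 * (C * ((N : ℝ) * ((M : ℝ) * (N : ℝ) ^ ((r - 1) * r) * (N : ℝ) ^ (r * k))) ^ ε)) ^ k := by
  classical
  set G := column k d N p v n with hG
  set R := C * ((N : ℝ) * ((M : ℝ) * (N : ℝ) ^ ((r - 1) * r) * (N : ℝ) ^ (r * k))) ^ ε with hR
  have hR0 : 0 ≤ R := by positivity
  have h1 : G.card ≤ k.factorial * (G.image Prod.fst).card := by
    refine card_le_of_perm fun x y y' hy hy' => ?_
    obtain ⟨hy, hv, -, hx, -⟩ := mem_filter.1 hy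
    obtain ⟨hy', hv', -⟩ := mem_filter.1 hy'
    exact exists_perm_of_common hd (mem_nondiag.1 hy).2.1 (mem_nondiag.1 hy').2.1 (hv p) (hv' p)
      fun i => hx i p
  have h2 : (G.image Prod.fst).card ≤ ⌊2 * R⌋₊ ^ k := by
    refine card_le_pow_of_prefix _ _ _ fun i x hx => Nat.le_floor ?_
    obtain ⟨⟨x₁, y⟩, hxy', hx₁⟩ := mem_image.1 hx
    obtain rfl : x₁ = x := hx₁
    obtain ⟨hxy, hv, hinj, hne, -⟩ := mem_filter.1 hxy'
    obtain ⟨⟨hxb, hyb⟩, -⟩ := mem_nondiag.1 hxy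
    have hvb : ∀ a, v a ∈ Icc 1 (N : ℤ) := fun a => by
      obtain ⟨i, hi⟩ := hv a
      exact hi ▸ mem_box.1 hyb i
    set W := ((n : ℤ) * diffProd v * prefixProd x₁ v i).natAbs with hW
    have hW0 : W ≠ 0 := Int.natAbs_ne_zero.2 (mul_ne_zero (mul_ne_zero
      (Nat.cast_ne_zero.2 hn.ne') (diffProd_ne_zero hinj)) (prefixProd_ne_zero hne i))
    have hWle : W ≤ M * N ^ ((r - 1) * r) * N ^ (r * k) := by
      rw [hW, Int.natAbs_mul, Int.natAbs_mul, Int.natAbs_natCast]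
      exact Nat.mul_le_mul (Nat.mul_le_mul hM (natAbs_diffProd_le hvb))
        (natAbs_prefixProd_le hN (mem_box.1 hxb) hvb i)
    set A := (Icc 1 N).filter fun s => s.primeFactors ⊆ W.primeFactors with hA
    have hAR : (A.card : ℝ) ≤ R := by
      refine (hdiv N W hW0).trans (mul_le_mul_of_nonneg_left (Real.rpow_le_rpow (by positivity)
        (mul_le_mul_of_nonneg_left ?_ (by positivity)) hε) hC)
      exact_mod_cast hWle
    -- The modulus `W` depends only on `n`, `v` and the earlier coordinates, so one set `A` serves
    -- every tuple with this prefix; the two images are the two signs of z i - v p.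
    have hsub : (((G.image Prod.fst).filter fun z => ∀ i' < i, z i' = x₁ i').image fun z => z i) ⊆
        (A.image fun s : ℕ => v p + (s : ℤ)) ∪ A.image fun s : ℕ => v p - (s : ℤ) := by
      intro t ht
      obtain ⟨z, hz, rfl⟩ := mem_image.1 ht
      obtain ⟨hz₁, hpre⟩ := mem_filter.1 hz
      obtain ⟨⟨z₁, y'⟩, hz₂, hz₃⟩ := mem_image.1 hz₁
      obtain rfl : z₁ = z := hz₃
      obtain ⟨hz₄, -, -, hne', hpr⟩ := mem_filter.1 hz₂
      obtain ⟨⟨hzb, -⟩, -⟩ := mem_nondiag.1 hz₄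
      have hpp : prefixProd z₁ v i = prefixProd x₁ v i := by
        refine Finset.prod_congr rfl fun i' hi' => Finset.prod_congr rfl fun a _ => ?_
        rw [← hpre i' (mem_Iio.1 hi')]
      have hmem : (z₁ i - v p).natAbs ∈ A := by
        refine mem_filter.2 ⟨mem_Icc.2 ⟨?_, natAbs_sub_le (mem_box.1 hzb i) (hvb p)⟩, ?_⟩
        · exact Int.natAbs_pos.2 (sub_ne_zero.2 (hne' i p))
        · have := hpr i
          simp only at this
          rwa [hpp] at this
      rw [mem_union, mem_image, mem_image]
      rcases le_total (v p) (z₁ i) with hle | hle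
      · exact Or.inl ⟨_, hmem, by omega⟩
      · exact Or.inr ⟨_, hmem, by omega⟩
    have hcard := (Finset.card_le_card hsub).trans ((Finset.card_union_le _ _).trans
      (add_le_add Finset.card_image_le Finset.card_image_le))
    calc _ ≤ ((A.card + A.card : ℕ) : ℝ) := by exact_mod_cast hcard
      _ ≤ 2 * R := by push_cast; linarith
  calc (G.card : ℝ) ≤ ((k.factorial * ⌊2 * R⌋₊ ^ k : ℕ) : ℝ) := by
        exact_mod_cast h1.trans (Nat.mul_le_mul_left _ h2)
    _ ≤ k.factorial * (2 * R) ^ k := by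
        push_cast
        refine mul_le_mul_of_nonneg_left (pow_le_pow_left₀ (by positivity)
          (Nat.floor_le (by positivity)) _) (by positivity)

theorem IsSol.symm {k d : ℕ} {x y : Fin k → ℤ} (h : IsSol k d x y) : IsSol k d y x :=
  fun j h1 h2 h3 => (h j h1 h2 h3).symm

open Classical in
/-- The nondiagonal solutions `(x, y)` for which `y` takes at least `r` values not taken by `x`. -/
noncomputable def generic (k d r N : ℕ) : Finset ((Fin k → ℤ) × (Fin k → ℤ)) :=
  (nondiag k d N).filter fun z => ∃ v : Fin r → ℤ, Function.Injective v ∧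
    (∀ a, ∃ i, z.2 i = v a) ∧ ∀ i a, z.1 i ≠ v a

theorem mem_generic {k d r N : ℕ} {x y : Fin k → ℤ} : (x, y) ∈ generic k d r N ↔
    (x, y) ∈ nondiag k d N ∧ ∃ v : Fin r → ℤ, Function.Injective v ∧
      (∀ a, ∃ i, y i = v a) ∧ ∀ i a, x i ≠ v a := by
  simp only [generic, mem_filter]

/-- The factor H ≪ N^(k-d) enters only once although it divides all r products; each value of the
truncated polynomial costs N^d. -/
theorem exists_mem_column {k d r N : ℕ} (hd : 2 * d < k) (hr : 0 < r)
    {z : (Fin k → ℤ) × (Fin k → ℤ)} (hz : z ∈ generic k d r N) :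
    ∃ p : Fin r, ∃ v ∈ box r N, ∃ n : ℕ, 0 < n ∧
      n ^ r ≤ 2 ^ (k + 1) * ((d + 1) * 2 ^ k) ^ r * N ^ (k - d + d * r) ∧
      z ∈ column k d N p v n := by
  obtain ⟨x, y⟩ := z
  obtain ⟨hz, v, hv, hvy, hvx⟩ := mem_generic.1 hz
  obtain ⟨⟨hxb, hyb⟩, hsol, -⟩ := mem_nondiag.1 hz
  have hvb : ∀ a, v a ∈ Icc 1 (N : ℤ) := fun a => by
    obtain ⟨i, hi⟩ := hvy a
    exact hi ▸ mem_box.1 hyb i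
  have hx : ∀ i, |x i| ≤ (N : ℤ) := fun i => abs_le_of_mem_Icc (mem_box.1 hxb i)
  have hy : ∀ i, |y i| ≤ (N : ℤ) := fun i => abs_le_of_mem_Icc (mem_box.1 hyb i)
  have hN : (0 : ℤ) ≤ N := Int.natCast_nonneg N
  have hprod : ∀ a, ∏ i, (v a - x i) =
      (-1) ^ (k - d) * (elem x (k - d) - elem y (k - d)) * trunc x d (v a) := fun a => by
    obtain ⟨i, hi⟩ := hvy a
    rw [← prod_sub_prod hd hsol, Finset.prod_eq_zero (f := fun i => v a - y i) (mem_univ i)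
      (by rw [hi, sub_self]), sub_zero]
  obtain ⟨p, n, hn, hnZ, hpr⟩ := exists_column hr hv hvx hprod
  refine ⟨p, v, mem_box.2 hvb, n, hn, hnZ.trans ?_, mem_filter.2 ⟨hz, hvy, hv, hvx, hpr⟩⟩
  zify
  rw [abs_mul, abs_mul, abs_pow, abs_neg, abs_one, one_pow, one_mul, Finset.abs_prod]
  calc |elem x (k - d) - elem y (k - d)| * ∏ a, |trunc x d (v a)|
      ≤ (2 ^ (k + 1) * (N : ℤ) ^ (k - d)) * ∏ _a : Fin r, ((d + 1) * 2 ^ k * (N : ℤ) ^ d) := by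
        refine mul_le_mul ?_ (Finset.prod_le_prod (fun _ _ => abs_nonneg _) fun a _ =>
          abs_trunc_le hx hN (abs_le_of_mem_Icc (hvb a)))
          (Finset.prod_nonneg fun _ _ => abs_nonneg _) (by positivity)
        calc _ ≤ |elem x (k - d)| + |elem y (k - d)| := abs_sub _ _
          _ ≤ 2 ^ k * (N : ℤ) ^ (k - d) + 2 ^ k * (N : ℤ) ^ (k - d) :=
            add_le_add (abs_elem_le hx hN _) (abs_elem_le hy hN _)
          _ = _ := by ring
    _ = 2 ^ (k + 1) * (((d : ℤ) + 1) * 2 ^ k) ^ r * (N : ℤ) ^ (k - d + d * r) := by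
        rw [Finset.prod_const, Finset.card_univ, Fintype.card_fin, mul_pow, ← pow_mul, pow_add]
        ring

theorem exists_card_generic_le {k d r : ℕ} (hd : 2 * d < k) (hr : 0 < r) {ε : ℝ} (hε : 0 < ε) :
    ∃ C : ℝ, ∀ N : ℕ, 0 < N →
      ((generic k d r N).card : ℝ) ≤ C * (N : ℝ) ^ (r + d + ((k : ℝ) - d) / r + ε) := by
  classical
  have hk : (0 : ℝ) < k := by exact_mod_cast (by omega : 0 < k)
  have hdk : (0 : ℝ) ≤ (k : ℝ) - d := sub_nonneg.2 (by exact_mod_cast (by omega : d ≤ k))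
  have hr' : (0 : ℝ) < r := by exact_mod_cast hr
  set c : ℝ := 2 ^ (k + 1) * ((d + 1) * 2 ^ k) ^ r with hc
  have hc0 : 0 < c := by positivity
  set A : ℝ := c ^ ((r : ℝ)⁻¹) with hA
  set μ : ℝ := ((k : ℝ) - d) / r + d with hμ
  set L : ℝ := 1 + (μ + ((r - 1) * r : ℕ) + (r * k : ℕ)) with hL
  have hμ0 : 0 ≤ μ := by positivity
  have hL0 : 0 < L := by positivity
  clear_value μ L
  -- `L` is the total exponent of N in the argument of the divisor bound, which is raised to the
  -- power `k`; dividing ε by `L * k` leaves exactly N^ε.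
  obtain ⟨C, hC, hdiv⟩ := exists_card_primeFactors_subset_le (ε := ε / (L * k)) (by positivity)
  refine ⟨r * A * (k.factorial * (2 * (C * A ^ (ε / (L * k)))) ^ k), fun N hN => ?_⟩
  have hN' : (0 : ℝ) < N := by exact_mod_cast hN
  set M : ℕ := ⌊A * (N : ℝ) ^ μ⌋₊ with hM
  have hMle : (M : ℝ) ≤ A * (N : ℝ) ^ μ := Nat.floor_le (by positivity)
  set R : ℝ := k.factorial * (2 * (C * ((N : ℝ) * ((M : ℝ) * (N : ℝ) ^ ((r - 1) * r) *
    (N : ℝ) ^ (r * k))) ^ (ε / (L * k)))) ^ k with hR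
  have hsub : generic k d r N ⊆ (univ : Finset (Fin r)).biUnion fun p =>
      (box r N).biUnion fun v => (Icc 1 M).biUnion fun n => column k d N p v n := by
    intro z hz
    obtain ⟨p, v, hv, n, hn, hnr, hmem⟩ := exists_mem_column hd hr hz
    refine mem_biUnion.2 ⟨p, mem_univ p, mem_biUnion.2 ⟨v, hv, mem_biUnion.2
      ⟨n, mem_Icc.2 ⟨hn, Nat.le_floor ?_⟩, hmem⟩⟩⟩
    have h1 : (n : ℝ) ^ r ≤ c * (N : ℝ) ^ (k - d + d * r) := by
      rw [hc]
      exact_mod_cast hnr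
    have h2 := Real.rpow_le_rpow (by positivity) h1 (inv_nonneg.2 hr'.le)
    rw [Real.pow_rpow_inv_natCast (Nat.cast_nonneg n) hr.ne',
      Real.mul_rpow hc0.le (by positivity), ← Real.rpow_natCast, ← Real.rpow_mul hN'.le] at h2
    have he : ((k - d + d * r : ℕ) : ℝ) * (r : ℝ)⁻¹ = μ := by
      rw [hμ]
      push_cast [Nat.cast_sub (show d ≤ k by omega)]
      field_simp
    rwa [he, ← hA] at h2
  have hcard : ((generic k d r N).card : ℝ) ≤ r * ((N : ℝ) ^ r * (M * R)) := by
    have h1 := (Finset.card_le_card hsub).trans (Finset.card_biUnion_le.trans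
      (Finset.sum_le_sum fun p _ => Finset.card_biUnion_le.trans
        (Finset.sum_le_sum fun v _ => Finset.card_biUnion_le)))
    calc ((generic k d r N).card : ℝ)
        ≤ ∑ p : Fin r, ∑ v ∈ box r N, ∑ n ∈ Icc 1 M, ((column k d N p v n).card : ℝ) := by
          exact_mod_cast h1
      _ ≤ ∑ p : Fin r, ∑ v ∈ box r N, ∑ n ∈ Icc 1 M, R := by
          refine Finset.sum_le_sum fun p _ => Finset.sum_le_sum fun v _ =>
            Finset.sum_le_sum fun n hn => ?_
          exact card_column_le hd hN hC.le (by positivity) hdiv p v (mem_Icc.1 hn).1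
            (mem_Icc.1 hn).2
      _ = r * ((N : ℝ) ^ r * (M * R)) := by
          simp only [Finset.sum_const, nsmul_eq_mul, card_box, Finset.card_univ, Fintype.card_fin,
            Nat.card_Icc, Nat.add_sub_cancel, Nat.cast_pow]
  have hRle : R ≤ k.factorial * (2 * (C * A ^ (ε / (L * k)))) ^ k * (N : ℝ) ^ ε := by
    have h1 : (N : ℝ) * ((M : ℝ) * (N : ℝ) ^ ((r - 1) * r) * (N : ℝ) ^ (r * k)) ≤
        A * (N : ℝ) ^ L := by
      calc (N : ℝ) * ((M : ℝ) * (N : ℝ) ^ ((r - 1) * r) * (N : ℝ) ^ (r * k))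
          ≤ N * ((A * (N : ℝ) ^ μ) * (N : ℝ) ^ ((r - 1) * r) * (N : ℝ) ^ (r * k)) := by gcongr
        _ = A * (N : ℝ) ^ L := by
          rw [hL, Real.rpow_add hN', Real.rpow_add hN', Real.rpow_add hN', Real.rpow_one,
            Real.rpow_natCast, Real.rpow_natCast]
          ring
    calc R ≤ k.factorial * (2 * (C * (A * (N : ℝ) ^ L) ^ (ε / (L * k)))) ^ k := by
          rw [hR]; gcongr
      _ = _ := by
          rw [Real.mul_rpow (by positivity) (by positivity), ← Real.rpow_mul hN'.le,
            ← mul_assoc C, ← mul_assoc 2, mul_pow _ ((N : ℝ) ^ _), ← Real.rpow_natCast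
            ((N : ℝ) ^ _), ← Real.rpow_mul hN'.le, ← mul_assoc]
          congr 2
          field_simp
  calc ((generic k d r N).card : ℝ) ≤ r * ((N : ℝ) ^ r * (M * R)) := hcard
    _ ≤ r * ((N : ℝ) ^ r * ((A * (N : ℝ) ^ μ) *
          (k.factorial * (2 * (C * A ^ (ε / (L * k)))) ^ k * (N : ℝ) ^ ε))) := by gcongr
    _ = _ := by
        rw [show (r : ℝ) + d + ((k : ℝ) - d) / r + ε = r + (μ + ε) by rw [hμ]; ring,
          Real.rpow_add hN', Real.rpow_add hN', Real.rpow_natCast]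
        ring

/-! ### Solutions with few distinct coordinates, and all nondiagonal solutions. -/

/-- Few tuples have few distinct coordinates. -/
theorem card_filter_card_image_le {k m N : ℕ} (hk : 0 < k) :
    ((box k N).filter fun y => (univ.image y).card ≤ m).card ≤ m ^ k * N ^ m := by
  classical
  calc _ ≤ ((univ ×ˢ box m N : Finset ((Fin k → Fin m) × (Fin m → ℤ))).image
        fun p => p.2 ∘ p.1).card := by
        refine Finset.card_le_card fun y hy => ?_
        obtain ⟨hyb, hc⟩ := mem_filter.1 hy
        -- `y` factors through an enumeration of its values, padded to length `m` by repeating a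
        -- coordinate.
        set e := (univ.image y).equivFin
        refine mem_image.2 ⟨(fun i => Fin.castLE hc (e ⟨y i, mem_image_of_mem y (mem_univ i)⟩),
          fun a => if h : (a : ℕ) < (univ.image y).card then (e.symm ⟨a, h⟩ : ℤ)
            else y ⟨0, hk⟩), mem_product.2 ⟨mem_univ _, mem_box.2 fun a => ?_⟩, ?_⟩
        · by_cases h : (a : ℕ) < (univ.image y).card
          · simp only [h, dif_pos]
            obtain ⟨i, -, hi⟩ := mem_image.1 (e.symm ⟨a, h⟩).2
            rw [← hi]
            exact mem_box.1 hyb i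
          · simp only [h, dif_neg, not_false_iff]
            exact mem_box.1 hyb _
        · funext i
          simp
    _ ≤ _ := Finset.card_image_le
    _ = m ^ k * N ^ m := by rw [card_product, card_box, Finset.card_univ]; simp

/-- The nondiagonal solutions with few distinct coordinates in the second block. -/
theorem card_filter_nondiag_le {k d m N : ℕ} (hd : 2 * d < k) (hN : 0 < N) :
    ((nondiag k d N).filter fun z => (univ.image z.2).card ≤ m).card ≤
      (k ^ k + k * k.factorial) * m ^ k * N ^ (m + 1) := by
  classical
  set Y := (box k N).filter fun y => (univ.image y).card ≤ m with hY
  set S := (nondiag k d N).filter fun z => (univ.image z.2).card ≤ m with hS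
  have hYS : ∀ z ∈ S, z.1 ∈ box k N ∧ z.2 ∈ Y ∧ IsSol k d z.1 z.2 := by
    rintro ⟨x, y⟩ hz
    obtain ⟨hz, hc⟩ := mem_filter.1 hz
    obtain ⟨⟨hx, hy⟩, hs, -⟩ := mem_nondiag.1 hz
    exact ⟨hx, mem_filter.2 ⟨hy, hc⟩, hs⟩
  have hYc : Y.card ≤ m ^ k * N ^ m := card_filter_card_image_le (by omega)
  -- Either every coordinate of `x` is a value of `y`, or some x i is missed by `y`, and then `y`
  -- and x i fix `x` up to permutation.
  have hsub : S ⊆ ((univ ×ˢ Y : Finset ((Fin k → Fin k) × (Fin k → ℤ))).image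
      fun p => (p.2 ∘ p.1, p.2)) ∪
      univ.biUnion fun i : Fin k => S.filter fun z => ∀ l, z.2 l ≠ z.1 i := by
    rintro ⟨x, y⟩ hz
    by_cases h : ∃ i, ∀ l, y l ≠ x i
    · obtain ⟨i, hi⟩ := h
      exact mem_union_right _ (mem_biUnion.2 ⟨i, mem_univ i, mem_filter.2 ⟨hz, hi⟩⟩)
    · push Not at h
      choose g hg using h
      exact mem_union_left _ (mem_image.2 ⟨(g, y), mem_product.2 ⟨mem_univ _, (hYS _ hz).2.1⟩,
        Prod.ext (funext hg) rfl⟩)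
  have h1 : ∀ i : Fin k, (S.filter fun z => ∀ l, z.2 l ≠ z.1 i).card ≤
      k.factorial * (N * Y.card) := by
    intro i
    set G := (S.filter fun z => ∀ l, z.2 l ≠ z.1 i).image fun z => ((z.1 i, z.2), z.1) with hG
    have hGS : ∀ t y x, ((t, y), x) ∈ G → x i = t ∧ (x, y) ∈ S ∧ ∀ l, y l ≠ t := by
      intro t y x h
      obtain ⟨⟨x', y'⟩, hz, he⟩ := mem_image.1 h
      simp only [Prod.mk.injEq] at he
      obtain ⟨⟨rfl, rfl⟩, rfl⟩ := he
      exact ⟨rfl, mem_filter.1 hz⟩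
    have hcard : (S.filter fun z => ∀ l, z.2 l ≠ z.1 i).card = G.card := by
      refine (Finset.card_image_of_injective _ ?_).symm
      rintro ⟨x, y⟩ ⟨x', y'⟩ h
      simp only [Prod.mk.injEq] at h ⊢
      exact ⟨h.2, h.1.2⟩
    rw [hcard]
    refine (card_le_of_perm ?_).trans (Nat.mul_le_mul_left _ ?_)
    · rintro ⟨t, y⟩ x x' hx hx'
      obtain ⟨hxt, hxS, hyt⟩ := hGS _ _ _ hx
      obtain ⟨hxt', hxS', -⟩ := hGS _ _ _ hx'
      exact exists_perm_of_common hd (hYS _ hxS).2.2.symm (hYS _ hxS').2.2.symm ⟨i, hxt⟩ ⟨i, hxt'⟩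
        hyt
    · calc (G.image Prod.fst).card ≤ (Icc 1 (N : ℤ) ×ˢ Y).card := by
            refine Finset.card_le_card fun p hp => ?_
            obtain ⟨⟨⟨t, y⟩, x⟩, hx, rfl⟩ := mem_image.1 hp
            obtain ⟨hxt, hxS, -⟩ := hGS _ _ _ hx
            exact mem_product.2 ⟨hxt ▸ mem_box.1 (hYS _ hxS).1 i, (hYS _ hxS).2.1⟩
        _ = N * Y.card := by rw [card_product]; simp
  calc S.card ≤ k ^ k * Y.card + k * (k.factorial * (N * Y.card)) := by
        refine (Finset.card_le_card hsub).trans ((Finset.card_union_le _ _).trans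
          (add_le_add (Finset.card_image_le.trans_eq ?_)
            (Finset.card_biUnion_le.trans ((Finset.sum_le_sum fun i _ => h1 i).trans_eq ?_))))
        · rw [card_product, Finset.card_univ]; simp
        · simp
    _ ≤ k ^ k * (N * Y.card) + k * (k.factorial * (N * Y.card)) := by
        gcongr
        exact Nat.le_mul_of_pos_left _ hN
    _ = (k ^ k + k * k.factorial) * (N * Y.card) := by ring
    _ ≤ (k ^ k + k * k.factorial) * (N * (m ^ k * N ^ m)) := by gcongr
    _ = _ := by ring

/-- Since H ≠ 0, the values common to `x` and `y` are roots of the truncated polynomial, at most `d`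
in number; if `x` misses at most r - 1 values of `y`, then `y` has at most d + r - 1 values. -/
theorem nondiag_subset {k d r N : ℕ} (hd : 2 * d < k) (hr : 0 < r) :
    nondiag k d N ⊆ generic k d r N ∪
      (nondiag k d N).filter fun z => (univ.image z.2).card ≤ d + r - 1 := by
  classical
  rintro ⟨x, y⟩ hz
  by_cases hg : r ≤ (univ.image y \ univ.image x).card
  · refine mem_union_left _ (mem_generic.2 ⟨hz, ?_⟩)
    set e := (univ.image y \ univ.image x).equivFin
    refine ⟨fun a => (e.symm (Fin.castLE hg a) : ℤ), ?_, fun a => ?_, fun i a h => ?_⟩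
    · exact Subtype.val_injective.comp (e.symm.injective.comp (Fin.castLE_injective hg))
    · obtain ⟨i, -, hi⟩ := mem_image.1 (mem_sdiff.1 (e.symm (Fin.castLE hg a)).2).1
      exact ⟨i, hi⟩
    · exact (mem_sdiff.1 (e.symm (Fin.castLE hg a)).2).2 (mem_image.2 ⟨i, mem_univ i, h⟩)
  · refine mem_union_right _ (mem_filter.2 ⟨hz, ?_⟩)
    obtain ⟨-, hsol, hperm⟩ := mem_nondiag.1 hz
    have hroot : (univ.image y ∩ univ.image x).card ≤ d := by
      refine card_le_of_trunc_eq_zero (k := k) (x := x) fun t ht => ?_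
      obtain ⟨hty, htx⟩ := mem_inter.1 ht
      obtain ⟨i, -, hi⟩ := mem_image.1 hty
      obtain ⟨l, -, hl⟩ := mem_image.1 htx
      have h := prod_sub_prod hd hsol t
      rw [Finset.prod_eq_zero (f := fun i => t - x i) (mem_univ l) (by rw [hl, sub_self]),
        Finset.prod_eq_zero (f := fun i => t - y i) (mem_univ i) (by rw [hi, sub_self]),
        sub_self] at h
      refine (mul_eq_zero.1 h.symm).resolve_left fun h0 => hperm (exists_perm_of_prod_eq fun t => ?_)
      have := prod_sub_prod hd hsol t
      rwa [h0, zero_mul, sub_eq_zero] at this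
    have := Finset.card_sdiff_add_card_inter (univ.image y) (univ.image x)
    simp only
    omega

theorem exists_card_nondiag_le {k d r : ℕ} (hd : 2 * d < k) (hr : 0 < r) {ε : ℝ} (hε : 0 < ε) :
    ∃ C : ℝ, 0 ≤ C ∧ ∀ N : ℕ, 0 < N →
      ((nondiag k d N).card : ℝ) ≤ C * (N : ℝ) ^ (r + d + ((k : ℝ) - d) / r + ε) := by
  classical
  obtain ⟨C, hC⟩ := exists_card_generic_le hd hr hε
  have hdk : (0 : ℝ) ≤ (k : ℝ) - d := sub_nonneg.2 (by exact_mod_cast (by omega : d ≤ k))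
  set K : ℕ := (k ^ k + k * k.factorial) * (d + r - 1) ^ k with hK
  refine ⟨|C| + K, by positivity, fun N hN => ?_⟩
  have hN1 : (1 : ℝ) ≤ N := by exact_mod_cast hN
  have h1 := (Finset.card_le_card (nondiag_subset (N := N) hd hr)).trans
    (Finset.card_union_le _ _)
  have h2 := card_filter_nondiag_le (m := d + r - 1) hd hN
  rw [← hK, show d + r - 1 + 1 = r + d by omega] at h2
  calc ((nondiag k d N).card : ℝ) ≤ (generic k d r N).card + K * (N : ℝ) ^ (r + d) := by
        exact_mod_cast h1.trans (Nat.add_le_add_left h2 _)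
    _ ≤ |C| * (N : ℝ) ^ (r + d + ((k : ℝ) - d) / r + ε) +
          K * (N : ℝ) ^ (r + d + ((k : ℝ) - d) / r + ε) := by
        refine add_le_add ((hC N hN).trans ?_) (mul_le_mul_of_nonneg_left ?_ (by positivity))
        · exact mul_le_mul_of_nonneg_right (le_abs_self C) (by positivity)
        · rw [← Real.rpow_natCast]
          refine Real.rpow_le_rpow_of_exponent_le hN1 ?_
          push_cast
          have : 0 ≤ ((k : ℝ) - d) / r := by positivity
          linarith
    _ = _ := by ring

/-! ### Passage to real X and choice of r. -/

theorem inBox_iff {s : ℕ} {X : ℝ} (hX : 0 ≤ X) {x : Fin s → ℤ} :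
    InBox X x ↔ x ∈ box s ⌊X⌋₊ := by
  rw [mem_box, InBox]
  refine forall_congr' fun i => ?_
  rw [mem_Icc, Int.natCast_floor_eq_floor hX, Int.le_floor]

theorem I_eq_T_add {k d : ℕ} {X : ℝ} (hX : 0 ≤ X) :
    I k d X = T k X + (nondiag k d ⌊X⌋₊).card := by
  have hsub : diagonals k X ⊆ solutions k d X := by
    rintro ⟨x, y⟩ ⟨hx, hy, σ, hσ⟩
    refine ⟨hx, hy, fun j _ _ _ => ?_⟩
    rw [← Equiv.sum_comp σ fun i => y i ^ j]
    exact Finset.sum_congr rfl fun i _ => congrArg (· ^ j) (hσ i)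
  have hdiff : solutions k d X \ diagonals k X = (nondiag k d ⌊X⌋₊ : Set _) := by
    ext ⟨x, y⟩
    rw [mem_coe, mem_nondiag, ← inBox_iff hX, ← inBox_iff hX]
    simp only [solutions, diagonals, Set.mem_sdiff, Set.mem_ofPred_eq, IsSol]
    tauto
  rw [I, T, ← Set.ncard_sdiff_add_ncard_of_subset hsub (finite_solutions k d X), hdiff,
    Set.ncard_coe_finset, add_comm]

theorem abs_I_sub_T {k d : ℕ} {X : ℝ} (hX : 0 ≤ X) :
    |(I k d X : ℝ) - T k X| = (nondiag k d ⌊X⌋₊).card := by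
  rw [I_eq_T_add hX, Nat.cast_add, add_sub_cancel_left, Nat.abs_cast]

/-- The bound for the number of nondiagonal solutions, uniformly in `d`. -/
theorem exists_abs_I_sub_T_le (k : ℕ) {r : ℕ} (hr : 0 < r) {ε : ℝ} (hε : 0 < ε) :
    ∃ C : ℝ, 0 ≤ C ∧ ∀ d : ℕ, 2 * d < k → ∀ X : ℝ, 1 ≤ X → ∀ e : ℝ,
      r + d + ((k : ℝ) - d) / r + ε ≤ e → |(I k d X : ℝ) - T k X| ≤ C * X ^ e := by
  have h : ∀ d : ℕ, ∃ C : ℝ, 0 ≤ C ∧ (2 * d < k → ∀ N : ℕ, 0 < N →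
      ((nondiag k d N).card : ℝ) ≤ C * (N : ℝ) ^ (r + d + ((k : ℝ) - d) / r + ε)) := by
    intro d
    by_cases hd : 2 * d < k
    · obtain ⟨C, h0, hC⟩ := exists_card_nondiag_le hd hr hε
      exact ⟨C, h0, fun _ => hC⟩
    · exact ⟨0, le_rfl, fun h => absurd h hd⟩
  choose C hC0 hC using h
  -- Only finitely many `d` are admissible for given `k`, so summing their constants gives
  -- uniformity in `d`.
  refine ⟨∑ d ∈ range k, C d, Finset.sum_nonneg fun d _ => hC0 d, fun d hd X hX e he => ?_⟩
  have hdk : (0 : ℝ) ≤ (k : ℝ) - d := sub_nonneg.2 (by exact_mod_cast (by omega : d ≤ k))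
  rw [abs_I_sub_T (by linarith)]
  calc ((nondiag k d ⌊X⌋₊).card : ℝ)
      ≤ C d * (⌊X⌋₊ : ℝ) ^ (r + d + ((k : ℝ) - d) / r + ε) :=
        hC d hd _ (Nat.floor_pos.2 hX)
    _ ≤ C d * X ^ (r + d + ((k : ℝ) - d) / r + ε) :=
        mul_le_mul_of_nonneg_left (Real.rpow_le_rpow (Nat.cast_nonneg _)
          (Nat.floor_le (by linarith)) (by positivity)) (hC0 d)
    _ ≤ C d * X ^ e :=
        mul_le_mul_of_nonneg_left (Real.rpow_le_rpow_of_exponent_le hX he) (hC0 d)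
    _ ≤ (∑ d ∈ range k, C d) * X ^ e :=
        mul_le_mul_of_nonneg_right (Finset.single_le_sum (fun d _ => hC0 d)
          (mem_range.2 (by omega))) (by positivity)

/-- The bound for the number of nondiagonal solutions with an almost optimal choice of `r`. -/
theorem exists_abs_I_sub_T_le_sqrt (k : ℕ) :
    ∃ C : ℝ, 0 ≤ C ∧ ∀ d : ℕ, 1 ≤ d → 2 * d < k → ∀ X : ℝ, 1 ≤ X → ∀ e : ℝ,
      2 * √(k : ℝ) + d + 1 ≤ e → |(I k d X : ℝ) - T k X| ≤ C * X ^ e := by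
  rcases Nat.eq_zero_or_pos k with rfl | hk
  · exact ⟨0, le_rfl, fun d _ hd => absurd hd (by omega)⟩
  have hk' : (0 : ℝ) < k := by exact_mod_cast hk
  have hs : 0 < √(k : ℝ) := Real.sqrt_pos.2 hk'
  -- r near √k balances r against k/r; the saving 1/√k from d ≥ 1 pays for ε.
  obtain ⟨C, h0, hC⟩ := exists_abs_I_sub_T_le k (r := ⌈√(k : ℝ)⌉₊) (Nat.ceil_pos.2 hs)
    (ε := 1 / √(k : ℝ)) (by positivity)
  refine ⟨C, h0, fun d hd1 hd X hX e he => hC d hd X hX e (le_trans ?_ he)⟩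
  have h1 : ((⌈√(k : ℝ)⌉₊ : ℕ) : ℝ) ≤ √(k : ℝ) + 1 := (Nat.ceil_lt_add_one hs.le).le
  have hdk : (0 : ℝ) ≤ (k : ℝ) - d := sub_nonneg.2 (by exact_mod_cast (by omega : d ≤ k))
  have h2 : ((k : ℝ) - d) / (⌈√(k : ℝ)⌉₊ : ℕ) ≤ √(k : ℝ) - 1 / √(k : ℝ) := by
    calc ((k : ℝ) - d) / (⌈√(k : ℝ)⌉₊ : ℕ) ≤ ((k : ℝ) - d) / √(k : ℝ) :=
          div_le_div_of_nonneg_left hdk hs (Nat.le_ceil _)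
      _ ≤ ((k : ℝ) - 1) / √(k : ℝ) := by
          have : (1 : ℝ) ≤ d := by exact_mod_cast hd1
          gcongr
      _ = √(k : ℝ) - 1 / √(k : ℝ) := by rw [sub_div, Real.div_sqrt]
  linarith

/-! ### The number of diagonal solutions. -/

theorem T_le {k : ℕ} {X : ℝ} (hX : 0 ≤ X) : T k X ≤ k.factorial * ⌊X⌋₊ ^ k := by
  classical
  have hsub : diagonals k X ⊆ ((univ ×ˢ box k ⌊X⌋₊ :
      Finset (Equiv.Perm (Fin k) × (Fin k → ℤ))).image fun p => (p.2 ∘ p.1, p.2) : Finset _) := by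
    rintro ⟨x, y⟩ ⟨-, hy, σ, hσ⟩
    exact mem_coe.2 (mem_image.2 ⟨(σ, y), mem_product.2 ⟨mem_univ _, (inBox_iff hX).1 hy⟩,
      Prod.ext (funext fun i => (hσ i).symm) rfl⟩)
  refine (Set.ncard_le_ncard hsub (Finset.finite_toSet _)).trans ?_
  rw [Set.ncard_coe_finset]
  refine Finset.card_image_le.trans_eq ?_
  rw [card_product, card_box, Finset.card_univ, Fintype.card_perm, Fintype.card_fin]

/-- A tuple with distinct coordinates has k! different rearrangements, and the falling factorial
counts such tuples. -/
theorem le_T {k : ℕ} {X : ℝ} (hX : 0 ≤ X) :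
    k.factorial * Nat.descFactorial ⌊X⌋₊ k ≤ T k X := by
  classical
  set N := ⌊X⌋₊ with hN
  set F : Equiv.Perm (Fin k) × (Fin k ↪ Fin N) → (Fin k → ℤ) × (Fin k → ℤ) :=
    fun p => (fun i => ((p.2 (p.1 i) : ℕ) : ℤ) + 1, fun i => ((p.2 i : ℕ) : ℤ) + 1) with hF
  have hinj : Function.Injective F := by
    rintro ⟨σ, f⟩ ⟨τ, g⟩ h
    simp only [hF, Prod.mk.injEq] at h
    obtain ⟨h1, h2⟩ := h
    have hfg : f = g := by
      ext i
      have : ((f i : ℕ) : ℤ) + 1 = ((g i : ℕ) : ℤ) + 1 := congrFun h2 i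
      omega
    subst hfg
    refine Prod.ext (Equiv.ext fun i => f.injective (Fin.ext ?_)) rfl
    have : ((f (σ i) : ℕ) : ℤ) + 1 = ((f (τ i) : ℕ) : ℤ) + 1 := congrFun h1 i
    change (f (σ i) : ℕ) = f (τ i)
    omega
  have hsub : ((univ.image F : Finset _) : Set _) ⊆ diagonals k X := by
    intro z hz
    obtain ⟨⟨σ, f⟩, -, rfl⟩ := mem_image.1 (mem_coe.1 hz)
    have hb : ∀ g : Fin k → Fin N, InBox X fun i => ((g i : ℕ) : ℤ) + 1 := fun g =>
      (inBox_iff hX).2 (mem_box.2 fun i => mem_Icc.2 (by have := (g i).2; omega))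
    exact ⟨hb fun i => f (σ i), hb f, σ, fun i => rfl⟩
  have h := Set.ncard_le_ncard hsub (finite_diagonals k X)
  rw [Set.ncard_coe_finset, Finset.card_image_of_injective _ hinj, Finset.card_univ,
    Fintype.card_prod, Fintype.card_perm, Fintype.card_embedding_eq, Fintype.card_fin,
    Fintype.card_fin] at h
  exact h

/-- The asymptotic formula for the number of diagonal solutions. -/
theorem abs_T_sub_le {k : ℕ} (hk : 0 < k) {X : ℝ} (hX : 1 ≤ X) :
    |(T k X : ℝ) - k.factorial * X ^ k| ≤ k.factorial * (k : ℝ) ^ 2 * X ^ (k - 1) := by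
  have hX0 : 0 < X := by linarith
  have hup : (T k X : ℝ) ≤ k.factorial * X ^ k := by
    calc (T k X : ℝ) ≤ k.factorial * (⌊X⌋₊ : ℝ) ^ k := by exact_mod_cast T_le hX0.le
      _ ≤ _ := by
        gcongr
        exact Nat.floor_le hX0.le
  have hpow : X ^ k = X * X ^ (k - 1) := by rw [← pow_succ', Nat.sub_add_cancel hk]
  have hlow : X ^ k - (k : ℝ) ^ 2 * X ^ (k - 1) ≤ (Nat.descFactorial ⌊X⌋₊ k : ℝ) := by
    rcases le_or_gt (k : ℝ) X with h | h
    · have hkN : k ≤ ⌊X⌋₊ := Nat.le_floor h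
      calc X ^ k - (k : ℝ) ^ 2 * X ^ (k - 1) = X ^ k * (1 + k * (-(k / X))) := by
            rw [hpow]; field_simp; ring
        -- Bernoulli's inequality, available since k ≤ X.
        _ ≤ X ^ k * (1 + -(k / X)) ^ k := by
            refine mul_le_mul_of_nonneg_left (one_add_mul_le_pow ?_ k) (by positivity)
            have : k / X ≤ 1 := (div_le_one hX0).2 h
            linarith
        _ = (X - k) ^ k := by
            rw [← mul_pow]; congr 1; field_simp; ring
        _ ≤ ((⌊X⌋₊ + 1 - k : ℕ) : ℝ) ^ k := by
            refine pow_le_pow_left₀ (by linarith) ?_ k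
            rw [Nat.cast_sub (by omega)]
            push_cast
            linarith [Nat.lt_floor_add_one X]
        _ ≤ _ := by exact_mod_cast Nat.pow_sub_le_descFactorial ⌊X⌋₊ k
    · have hk1 : (1 : ℝ) ≤ k := by exact_mod_cast hk
      have : X ^ k ≤ (k : ℝ) ^ 2 * X ^ (k - 1) := by
        rw [hpow]
        gcongr
        nlinarith
      linarith [(Nat.cast_nonneg (Nat.descFactorial ⌊X⌋₊ k) : (0 : ℝ) ≤ _)]
  have hle : (k.factorial : ℝ) * Nat.descFactorial ⌊X⌋₊ k ≤ T k X := by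
    exact_mod_cast le_T hX0.le
  have := mul_le_mul_of_nonneg_left hlow (Nat.cast_nonneg (α := ℝ) k.factorial)
  rw [abs_sub_comm, abs_of_nonneg (by linarith)]
  linarith

end Paucity

/-! ### Deduction of the three estimates. -/

theorem corollary1p3 :
    (∀ k : ℕ, ∃ C : ℝ, ∀ d : ℕ, 1 ≤ d → 4 * d + 3 ≤ k → ∀ X : ℝ, 1 ≤ X →
      |(Paucity.I k d X : ℝ) - (Nat.factorial k : ℝ) * X ^ k|
        ≤ C * X ^ ((k : ℝ) - 1 / 2)) ∧
    (∀ k : ℕ, ∃ C : ℝ, ∀ d : ℕ, 1 ≤ d → (d : ℝ) ≤ (k : ℝ) / 4 → ∀ X : ℝ, 1 ≤ X →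
      |(Paucity.I k d X : ℝ) - (Paucity.T k X : ℝ)|
        ≤ C * X ^ Real.sqrt (4 * (k : ℝ) * ((d : ℝ) + 1) + ((d : ℝ) + 1) ^ 2)) ∧
    (∃ η₀ : ℝ, 0 < η₀ ∧ ∀ k : ℕ, ∃ C : ℝ, ∀ η : ℝ, 0 < η → η ≤ η₀ →
      ∀ d : ℕ, 1 ≤ d → (d : ℝ) ≤ η ^ 2 * (k : ℝ) → ∀ X : ℝ, 1 ≤ X →
        |(Paucity.I k d X : ℝ) - (Paucity.T k X : ℝ)| ≤ C * X ^ (3 * η * (k : ℝ))) := by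
  refine ⟨fun k => ?_, fun k => ?_, 1 / 2, by norm_num, fun k => ?_⟩
  -- With r = 2 and ε = 1/4 the exponent is (k + d)/2 + 9/4, at most k - 1/2 because k - d ≥ 3d + 3
  -- ≥ 6.
  · obtain ⟨C, -, hC⟩ := Paucity.exists_abs_I_sub_T_le k two_pos (ε := 1 / 4) (by norm_num)
    refine ⟨C + k.factorial * (k : ℝ) ^ 2, fun d hd hdk X hX => ?_⟩
    have hd' : (1 : ℝ) ≤ d := by exact_mod_cast hd
    have hdk' : 4 * (d : ℝ) + 3 ≤ k := by exact_mod_cast hdk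
    have h1 := hC d (by omega) X hX ((k : ℝ) - 1 / 2) (by push_cast; linarith)
    have h2 := Paucity.abs_T_sub_le (k := k) (by omega) hX
    have h3 : X ^ (k - 1) ≤ X ^ ((k : ℝ) - 1 / 2) := by
      rw [← Real.rpow_natCast]
      refine Real.rpow_le_rpow_of_exponent_le hX ?_
      rw [Nat.cast_sub (by omega)]
      push_cast
      linarith
    calc _ ≤ |(Paucity.I k d X : ℝ) - Paucity.T k X| +
          |(Paucity.T k X : ℝ) - k.factorial * X ^ k| := abs_sub_le _ _ _
      _ ≤ C * X ^ ((k : ℝ) - 1 / 2) + k.factorial * (k : ℝ) ^ 2 * X ^ ((k : ℝ) - 1 / 2) :=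
          add_le_add h1 (h2.trans (mul_le_mul_of_nonneg_left h3 (by positivity)))
      _ = _ := by ring
  · obtain ⟨C, -, hC⟩ := Paucity.exists_abs_I_sub_T_le_sqrt k
    refine ⟨C, fun d hd hdk X hX => ?_⟩
    have hd' : (1 : ℝ) ≤ d := by exact_mod_cast hd
    have h4 : 4 * d ≤ k := by exact_mod_cast (by linarith : 4 * (d : ℝ) ≤ k)
    refine hC d hd (by omega) X hX _ (Real.le_sqrt_of_sq_le ?_)
    have hs := Real.sq_sqrt (Nat.cast_nonneg (α := ℝ) k)
    have hs2 : 2 ≤ √(k : ℝ) := Real.le_sqrt_of_sq_le (by linarith)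
    set s := √(k : ℝ)
    -- After squaring 2s + d + 1 with s² = k, the claim reduces to s(d + 1) ≤ s²d, true since s ≥ 2
    -- and d ≥ 1.
    have : s * (d + 1) ≤ s * (s * d) := by
      refine mul_le_mul_of_nonneg_left ?_ (by linarith)
      nlinarith
    rw [← hs]
    nlinarith
  · obtain ⟨C, -, hC⟩ := Paucity.exists_abs_I_sub_T_le_sqrt k
    refine ⟨C, fun η hη hη2 d hd hdk X hX => ?_⟩
    have hd' : (1 : ℝ) ≤ d := by exact_mod_cast hd
    have hk0 : (0 : ℝ) ≤ k := Nat.cast_nonneg k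
    have hηk : η ^ 2 * (k : ℝ) ≤ η * k / 2 := by
      have := mul_le_mul_of_nonneg_right hη2 (by positivity : 0 ≤ η * (k : ℝ))
      linarith
    have h2k : η * k / 2 ≤ (k : ℝ) / 4 := by
      have := mul_le_mul_of_nonneg_right hη2 hk0
      linarith
    have h4 : 4 * d ≤ k := by exact_mod_cast (by linarith : 4 * (d : ℝ) ≤ k)
    refine hC d hd (by omega) X hX _ ?_
    -- From 1 ≤ d ≤ η²k. The exponent is then at most 2ηk + 2d, and η ≤ 1/2 gives 2d ≤ 2η²k ≤ ηk.
    have hs : √(k : ℝ) ≤ η * k := by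
      refine Real.sqrt_le_iff.2 ⟨by positivity, ?_⟩
      have := mul_le_mul_of_nonneg_right (hd'.trans hdk) hk0
      linarith
    linarith
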